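/- Let $r\ge 1$ and $\ell\ge 1$ be integers, $\underline x=(x_1,\dots,x_r)$, and let $\mathcal P_j=\{P_{j1}(\underline x),\dots,P_{js_j}(\underline x)\}$, $j=1,\dots,\ell$, be $\ell$ finite families of nonzero polynomials in $\mathbb Z[\underline x]$, each family being coprime. Here a finite family $S\subset\mathbb Z[\underline x]$ is called coprime if no polynomial $D\in\mathbb Q[\underline x]$ with $\deg D>0$ divides all members of $S$ in $\mathbb Q[\underline x]$. For such a finite family $S$ put $$\mathcal R(S)=\{\underline n\in\mathbb Z^r \mid \gcd_{P\in S} P(\underline n)=1\},$$ and let $\mathcal R=\bigcap_{j=1}^{\ell}\mathcal R(\mathcal P_j)$. The density of a set $T\subset\mathbb Z^r$ is $$\mu(T)=\lim_{B\to+\infty}\frac{\#\big(T\cap\{0,\dots,B-1\}^r\big)}{B^r}$$ when this limit exists. Let $\Pi\subset\mathbb Z[\underline x]$ be the set of all products $A_1\cdots A_\ell$ with $A_j\in\mathcal P_j$ for $j=1,\dots,\ell$, and for a prime $p$ let $$c_p=\#\{\underline n\in(\mathbb Z/p\mathbb Z)^r \mid Q(\underline n)=0 \text{ in } \mathbb Z/p\mathbb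 Z \text{ for all } Q\in\Pi\}.$$ Then: (a) The elements of $\Pi$ are nonzero, and $\Pi$ is coprime. (b) $\mathcal R=\mathcal R(\Pi)$. (c) The density $\mu(\mathcal R)$ exists and $$\mu(\mathcal R)=\prod_{p\text{ prime}}\left(1-\frac{c_p}{p^r}\right),$$ where the product is the limit of its finite partial products (over finite sets of primes, ordered by inclusion), a limit which exists and may be $0$. (d) For every prime $p$, we have $c_p=p^r$ if and only if for every $\underline n\in\mathbb Z^r$ there exists $j\in\{1,\dots,\ell\}$ such that $p$ divides all the values $P_{j1}(\underline n),\dots,P_{js_j}(\underline n)$. -/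

import Mathlib

open Filter Topology

namespace PolyFamilies

/-- The polynomials of the finite family `S ⊂ ℤ[x₁, …, x_r]` are coprime (over `ℚ`): no polynomial
`D ∈ ℚ[x₁, …, x_r]` of positive degree divides all of them. -/
def CoprimePolys {r : ℕ} (S : Finset (MvPolynomial (Fin r) ℤ)) : Prop :=
  ¬ ∃ D : MvPolynomial (Fin r) ℚ, 0 < D.totalDegree ∧
    ∀ P ∈ S, D ∣ MvPolynomial.map (Int.castRingHom ℚ) P

/-- The good set `R(S)`: the points of `ℤ^r` at which the values of the members of `S` have
gcd equal to `1`. -/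
def goodSet {r : ℕ} (S : Finset (MvPolynomial (Fin r) ℤ)) : Set (Fin r → ℤ) :=
  {n | S.gcd (fun P => MvPolynomial.eval n P) = 1}

/-- The set `Π` of all products `A₁ ⋯ A_ℓ` with `A_j ∈ F j`. -/
noncomputable def products {r ℓ : ℕ} (F : Fin ℓ → Finset (MvPolynomial (Fin r) ℤ)) :
    Finset (MvPolynomial (Fin r) ℤ) :=
  (Fintype.piFinset F).image (fun A => ∏ j, A j)

/-- The box `{0, …, B - 1}^r`. -/
def box (r B : ℕ) : Set (Fin r → ℤ) :=
  {n | ∀ i, 0 ≤ n i ∧ n i < (B : ℤ)}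

/-- The density `μ(S)` exists and equals `δ`. -/
def HasDensity {r : ℕ} (S : Set (Fin r → ℤ)) (δ : ℝ) : Prop :=
  Tendsto (fun B : ℕ => ((S ∩ box r B).ncard : ℝ) / ((box r B).ncard : ℝ)) atTop (𝓝 δ)

/-- The number `c_p` of common zeros in `(ℤ/pℤ)^r` of the members of `S`. -/
noncomputable def zeroCount {r : ℕ} (S : Finset (MvPolynomial (Fin r) ℤ)) (p : ℕ) : ℕ :=
  {n : Fin r → ZMod p | ∀ Q ∈ S,
    MvPolynomial.eval n (MvPolynomial.map (Int.castRingHom (ZMod p)) Q) = 0}.ncard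

end PolyFamilies

/-!
The proof is Ekedahl's sieve. For finitely many primes the Chinese remainder theorem gives the
density of the points at which none of them divides all the values of the family, so it suffices
that the points at which some prime `p > M` divides all the values have upper density tending to `0`
as `M → ∞`. This goes by induction on the number `r` of variables. View the polynomials as
polynomials in `x₀` over the ring of the other variables. Either `p` divides the values of all their
coefficients, which form a coprime family in fewer variables, or, once the other variables are
fixed, `x₀` is confined to boundedly many residues modulo `p`. Coprimality also puts a nonzero
polynomial `h` free of `x₀` into the ideal of the family, so `p ∣ h` at every bad point. For
`M < p ≤ B` the Schwartz–Zippel bound for `h`, together with the bound on the residues of `x₀`,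
leaves `O(B ^ r / p ^ 2)` points in a box of side `B`, and `∑ 1 / p ^ 2` converges; for `p > B` a
nonzero value of `h` has boundedly many such prime divisors, which leaves `O(B ^ (r - 1))` points.
-/

namespace PolyFamilies

open MvPolynomial

/-! ### Elimination -/

section Elimination

open scoped Polynomial

/-- The gcd of the family over the fraction field has a primitive multiple over `R`, which by
Gauss's lemma divides the family over `R`. -/
theorem isUnit_of_forall_dvd_map {R : Type*} (K : Type*) [CommRing R] [IsDomain R]
    [NormalizedGCDMonoid R] [Field K] [Algebra R K] [IsFractionRing R K] {S : Set R[X]}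
    (hS : ∀ D : R[X], (∀ f ∈ S, D ∣ f) → D.natDegree = 0) {g : K[X]}
    (hg : ∀ f ∈ S, g ∣ f.map (algebraMap R K)) : IsUnit g := by
  have hinj : Function.Injective (algebraMap R K) := IsFractionRing.injective R K
  have hg0 : g ≠ 0 := by
    rintro rfl
    have hX := hS Polynomial.X fun f hf => by
      simp [(Polynomial.map_eq_zero_iff hinj).1 (zero_dvd_iff.1 (hg f hf))]
    simp at hX
  set G := IsLocalization.integerNormalization (nonZeroDivisors R) g
  obtain ⟨b, hb, hbG⟩ := IsLocalization.integerNormalization_spec (nonZeroDivisors R) g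
  have hb0 : algebraMap R K b ≠ 0 :=
    IsLocalization.to_map_ne_zero_of_mem_nonZeroDivisors K le_rfl hb
  have hG : G.map (algebraMap R K) = Polynomial.C (algebraMap R K b) * g := by
    rw [hbG, Polynomial.C_mul', algebraMap_smul]
  have hG_dvd : G.map (algebraMap R K) ∣ g := by
    rw [hG, (Polynomial.isUnit_C.2 hb0.isUnit).mul_left_dvd]
  have hG_deg : G.natDegree = 0 := by
    rw [← Polynomial.natDegree_primPart]
    refine hS _ fun f hf => G.isPrimitive_primPart.dvd_of_fraction_map_dvd_fraction_map (K := K) ?_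
    exact (Polynomial.map_dvd _ G.primPart_dvd).trans (hG_dvd.trans (hg f hf))
  rw [Polynomial.isUnit_iff_degree_eq_zero, Polynomial.degree_eq_natDegree hg0,
    ← Polynomial.natDegree_C_mul hb0, ← hG, Polynomial.natDegree_map_eq_of_injective hinj, hG_deg,
    Nat.cast_zero]

theorem exists_C_mem_span {R : Type*} [CommRing R] [IsDomain R] [NormalizedGCDMonoid R]
    {S : Set R[X]} (hS : ∀ D : R[X], (∀ f ∈ S, D ∣ f) → D.natDegree = 0) :
    ∃ c : R, c ≠ 0 ∧ Polynomial.C c ∈ Ideal.span S := by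
  let K := FractionRing R
  let : Algebra R[X] K[X] := Polynomial.algebra R K
  have := Polynomial.isLocalization (nonZeroDivisors R) K
  have hspan : (Ideal.span S).map (algebraMap R[X] K[X]) = ⊤ := by
    obtain ⟨g, hg⟩ := IsPrincipalIdealRing.principal ((Ideal.span S).map (algebraMap R[X] K[X]))
    rw [Ideal.submodule_span_eq] at hg
    rw [hg, Ideal.span_singleton_eq_top]
    refine isUnit_of_forall_dvd_map K hS fun f hf => ?_
    rw [← Ideal.mem_span_singleton, ← hg]
    exact Ideal.mem_map_of_mem (algebraMap R[X] K[X]) (Ideal.subset_span hf)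
  obtain ⟨_, ⟨c, hc, rfl⟩, hcS⟩ := (IsLocalization.algebraMap_mem_map_algebraMap_iff
    ((nonZeroDivisors R).map (Polynomial.C : R →+* R[X])) K[X] (Ideal.span S) 1).1
    (hspan ▸ Submodule.mem_top)
  exact ⟨c, nonZeroDivisors.ne_zero hc, by simpa using hcS⟩

end Elimination

/-- Coprimality up to constants: the common divisors of the members of `S` are nonzero constants.
In contrast to `CoprimePolys`, it forces some member of `S` to be nonzero even when there are no
variables, so that it can be proved and used by induction on the number of variables. -/
def CoprimeUpToConst {σ R : Type*} [CommSemiring R] (S : Finset (MvPolynomial σ R)) : Prop :=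
  ∀ D : MvPolynomial σ R, (∀ P ∈ S, D ∣ P) → ∃ c ≠ 0, D = C c

theorem CoprimePolys.coprimeUpToConst {r : ℕ} (hr : 1 ≤ r) {S : Finset (MvPolynomial (Fin r) ℤ)}
    (hS : CoprimePolys S) : CoprimeUpToConst S := by
  intro D hD
  have hdeg : D.totalDegree = 0 := by
    by_contra hD0
    refine hS ⟨map (Int.castRingHom ℚ) D, ?_, fun P hP => map_dvd _ (hD P hP)⟩
    rw [totalDegree, support_map_of_injective _ (RingHom.injective_int _)]
    exact Nat.pos_of_ne_zero hD0
  refine ⟨D.coeff 0, fun hD0 => ?_, totalDegree_eq_zero_iff_eq_C.1 hdeg⟩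
  rw [totalDegree_eq_zero_iff_eq_C.1 hdeg, hD0, C_0] at hD
  refine hS ⟨X ⟨0, hr⟩, by simp, fun P hP => ?_⟩
  simp [zero_dvd_iff.1 (hD P hP)]

open Classical in
/-- The coefficients of the members of `S`, seen as univariate polynomials in the variable of
index `0`. -/
noncomputable def coeffFamily {R : Type*} [CommSemiring R] {r : ℕ}
    (S : Finset (MvPolynomial (Fin (r + 1)) R)) : Finset (MvPolynomial (Fin r) R) :=
  S.biUnion fun f => (finSuccEquiv R r f).coeffs

theorem mem_coeffFamily {R : Type*} [CommSemiring R] {r : ℕ}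
    {S : Finset (MvPolynomial (Fin (r + 1)) R)} {g : MvPolynomial (Fin r) R} :
    g ∈ coeffFamily S ↔ ∃ f ∈ S, g ∈ (finSuccEquiv R r f).coeffs := by
  simp only [coeffFamily, Finset.mem_biUnion]

theorem finSuccEquiv_rename_succ {R : Type*} [CommSemiring R] {r : ℕ} (h : MvPolynomial (Fin r) R) :
    finSuccEquiv R r (rename Fin.succ h) = Polynomial.C h := by
  induction h using MvPolynomial.induction_on with
  | C a => simp [finSuccEquiv_apply]
  | add p q hp hq => simp only [map_add, hp, hq]
  | mul_X p i hp => simp only [map_mul, hp, rename_X, finSuccEquiv_X_succ]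

theorem CoprimeUpToConst.coeffFamily {R : Type*} [CommSemiring R] {r : ℕ}
    {S : Finset (MvPolynomial (Fin (r + 1)) R)} (hS : CoprimeUpToConst S) :
    CoprimeUpToConst (coeffFamily S) := by
  intro D hD
  obtain ⟨c, hc, hDc⟩ := hS (rename Fin.succ D) fun P hP => by
    rw [← map_dvd_iff (finSuccEquiv R r), finSuccEquiv_rename_succ, Polynomial.C_dvd_iff_dvd_coeff]
    intro i
    by_cases h0 : (finSuccEquiv R r P).coeff i = 0
    · simp only [h0, dvd_zero]
    · exact hD _ (mem_coeffFamily.2 ⟨P, hP, Polynomial.coeff_mem_coeffs h0⟩)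
  refine ⟨c, hc, rename_injective _ (Fin.succ_injective r) ?_⟩
  rw [hDc, rename_C]

theorem CoprimeUpToConst.exists_rename_succ_mem_span {R : Type*} [CommRing R] [IsDomain R]
    [UniqueFactorizationMonoid R] {r : ℕ} {S : Finset (MvPolynomial (Fin (r + 1)) R)}
    (hS : CoprimeUpToConst S) :
    ∃ h : MvPolynomial (Fin r) R, h ≠ 0 ∧
      rename Fin.succ h ∈ Ideal.span (S : Set (MvPolynomial (Fin (r + 1)) R)) := by
  let : StrongNormalizationMonoid (MvPolynomial (Fin r) R) :=
    UniqueFactorizationMonoid.strongNormalizationMonoid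
  let : NormalizedGCDMonoid (MvPolynomial (Fin r) R) :=
    UniqueFactorizationMonoid.toNormalizedGCDMonoid _
  obtain ⟨h, h0, hh⟩ := exists_C_mem_span (S := finSuccEquiv R r '' S) fun D hD => by
    obtain ⟨E, rfl⟩ := (finSuccEquiv R r).surjective D
    obtain ⟨c, -, rfl⟩ := hS E fun P hP => (map_dvd_iff (finSuccEquiv R r)).1 (hD _ ⟨P, hP, rfl⟩)
    rw [natDegree_finSuccEquiv, degreeOf_C]
  refine ⟨h, h0, ?_⟩
  rw [← finSuccEquiv_rename_succ, ← Ideal.map_span, Ideal.mem_map_of_equiv] at hh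
  obtain ⟨f, hf, hfh⟩ := hh
  rwa [← (finSuccEquiv R r).injective hfh]

/-! ### Counting in boxes -/

theorem box_eq_pi (r B : ℕ) : box r B = Set.univ.pi fun _ => Set.Ico (0 : ℤ) B := by
  ext n
  simp only [box, Set.mem_ofPred_eq, Set.mem_univ_pi, Set.mem_Ico]

instance (r B : ℕ) : Finite (box r B) := by
  rw [box_eq_pi]
  exact (Set.Finite.pi fun _ => Set.finite_Ico (0 : ℤ) B).to_subtype

theorem ncard_univ_pi {ι : Type*} [Fintype ι] {α : ι → Type*} (A : ∀ i, Set (α i)) :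
    (Set.univ.pi A).ncard = ∏ i, (A i).ncard := by
  simp only [← Nat.card_coe_set_eq]
  rw [Nat.card_congr (Equiv.Set.univPi A), Nat.card_pi]

theorem ncard_le_mul_ncard_of_mapsTo {α β : Type*} {s : Set α} {t : Set β} {f : α → β} {c : ℕ}
    (ht : t.Finite) (hf : Set.MapsTo f s t) (hc : ∀ b ∈ t, {a ∈ s | f a = b}.ncard ≤ c) :
    s.ncard ≤ c * t.ncard := by
  classical
  rcases s.finite_or_infinite with hs | hs
  · lift s to Finset α using hs
    lift t to Finset β using ht
    simp only [Set.ncard_coe_finset, Finset.mem_coe] at hc ⊢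
    refine Finset.card_le_mul_card_image_of_maps_to hf c fun b hb => ?_
    rw [← Set.ncard_coe_finset, Finset.coe_filter]
    exact hc b hb
  · rw [hs.ncard]
    exact Nat.zero_le _

theorem mul_ncard_le_ncard_of_mapsTo {α β : Type*} {s : Set α} {t : Set β} {f : α → β} {c : ℕ}
    (hs : s.Finite) (ht : t.Finite) (hf : Set.MapsTo f s t)
    (hc : ∀ b ∈ t, c ≤ {a ∈ s | f a = b}.ncard) : c * t.ncard ≤ s.ncard := by
  classical
  lift s to Finset α using hs
  lift t to Finset β using ht
  simp only [Set.ncard_coe_finset, Finset.mem_coe] at hc ⊢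
  refine Finset.mul_card_image_le_card_of_maps_to hf c fun b hb => ?_
  rw [← Set.ncard_coe_finset, Finset.coe_filter]
  exact hc b hb

/-- The number of elements of `A` among `0, …, B - 1`. -/
noncomputable def lineCount (A : Set ℤ) (B : ℕ) : ℕ :=
  (A ∩ Set.Ico 0 (B : ℤ)).ncard

/-- The number of points of `T` in the box `{0, …, B - 1}^r`. -/
noncomputable def boxCount {r : ℕ} (T : Set (Fin r → ℤ)) (B : ℕ) : ℕ :=
  (T ∩ box r B).ncard

theorem boxCount_univ_pi {r : ℕ} (A : Fin r → Set ℤ) (B : ℕ) :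
    boxCount (Set.univ.pi A) B = ∏ i, lineCount (A i) B := by
  rw [boxCount, box_eq_pi, ← Set.pi_inter_distrib, ncard_univ_pi]
  rfl

theorem ncard_box (r B : ℕ) : (box r B).ncard = B ^ r := by
  simp [box_eq_pi, ncard_univ_pi, Set.ncard_eq_toFinset_card']

theorem boxCount_univ (r B : ℕ) : boxCount (Set.univ : Set (Fin r → ℤ)) B = B ^ r := by
  rw [boxCount, Set.univ_inter, ncard_box]

theorem hasDensity_iff {r : ℕ} {T : Set (Fin r → ℤ)} {δ : ℝ} :
    HasDensity T δ ↔ Tendsto (fun B : ℕ => (boxCount T B : ℝ) / (B : ℝ) ^ r) atTop (𝓝 δ) := by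
  simp only [HasDensity, ncard_box, boxCount, Nat.cast_pow]

theorem boxCount_mono {r : ℕ} {T U : Set (Fin r → ℤ)} {B : ℕ} (h : T ∩ box r B ⊆ U) :
    boxCount T B ≤ boxCount U B :=
  Set.ncard_le_ncard (Set.subset_inter h Set.inter_subset_right) (Set.toFinite _)

theorem boxCount_union_le {r : ℕ} (T U : Set (Fin r → ℤ)) (B : ℕ) :
    boxCount (T ∪ U) B ≤ boxCount T B + boxCount U B := by
  rw [boxCount, Set.union_inter_distrib_right]
  exact Set.ncard_union_le _ _

theorem boxCount_biUnion_le {ι : Type*} {r : ℕ} (s : Finset ι) (T : ι → Set (Fin r → ℤ)) (B : ℕ) :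
    boxCount (⋃ i ∈ s, T i) B ≤ ∑ i ∈ s, boxCount (T i) B := by
  simp only [boxCount, Set.iUnion_inter]
  exact Finset.set_ncard_biUnion_le s _

theorem boxCount_le_mul_boxCount_of_tail {r B c : ℕ} {T : Set (Fin (r + 1) → ℤ)}
    {U : Set (Fin r → ℤ)} (hTU : ∀ m ∈ T, m ∈ box (r + 1) B → Fin.tail m ∈ U)
    (hc : ∀ n ∈ U, n ∈ box r B → lineCount {x | (Fin.cons x n : Fin (r + 1) → ℤ) ∈ T} B ≤ c) :
    boxCount T B ≤ c * boxCount U B := by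
  refine ncard_le_mul_ncard_of_mapsTo (f := Fin.tail) (Set.toFinite _)
    (fun m hm => ⟨hTU m hm.1 hm.2, fun i => hm.2 i.succ⟩) fun n hn => ?_
  refine (Set.ncard_le_ncard_of_injOn (fun m => m 0) ?_ ?_
    ((Set.finite_Ico _ _).inter_of_right _)).trans (hc n hn.1 hn.2)
  · rintro m ⟨⟨hmT, hm⟩, rfl⟩
    exact ⟨by simpa [Fin.cons_self_tail] using hmT, hm 0⟩
  · rintro m ⟨-, rfl⟩ m' ⟨-, hm'⟩ h0
    rw [← Fin.cons_self_tail m, ← Fin.cons_self_tail m', hm']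
    exact congrArg (Fin.cons · _) h0

/-! ### Residue conditions -/

theorem lineCount_residue_mem_Icc {N : ℕ} [NeZero N] (a : ZMod N) (B : ℕ) :
    lineCount {x | (x : ZMod N) = a} B ∈ Set.Icc (B / N) (B / N + 1) := by
  have h : lineCount {x | (x : ZMod N) = a} B = B.count (· ≡ a.val [MOD N]) := by
    rw [Nat.count_eq_card_filter_range, lineCount, ← Set.ncard_coe_finset,
      ← Set.ncard_image_of_injective _ (Nat.cast_injective (R := ℤ))]
    congr 1
    ext x
    simp only [Set.mem_inter_iff, Set.mem_ofPred_eq, Set.mem_Ico, Finset.coe_filter,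
      Finset.mem_range, Set.mem_image, ← ZMod.natCast_eq_natCast_iff, ZMod.natCast_zmod_val]
    constructor
    · rintro ⟨hx, h0, hB⟩
      lift x to ℕ using h0
      exact ⟨x, ⟨by exact_mod_cast hB, by simpa using hx⟩, rfl⟩
    · rintro ⟨y, ⟨hB, hy⟩, rfl⟩
      exact ⟨by simpa using hy, by positivity, by exact_mod_cast hB⟩
  rw [h, Nat.count_modEq_card B (NeZero.pos N)]
  split_ifs <;> simp

theorem lineCount_cast_mem_le {N : ℕ} [NeZero N] (A : Set (ZMod N)) (B : ℕ) :
    lineCount {x | (x : ZMod N) ∈ A} B ≤ (B / N + 1) * A.ncard := by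
  refine ncard_le_mul_ncard_of_mapsTo (f := fun x : ℤ => (x : ZMod N)) (Set.toFinite _)
    (fun x hx => hx.1) fun a _ => ?_
  refine (Set.ncard_le_ncard ?_ ((Set.finite_Ico _ _).inter_of_right _)).trans
    (lineCount_residue_mem_Icc a B).2
  exact fun x hx => ⟨hx.2, hx.1.2⟩

/-- Reduction of the coordinates of a point modulo `N`. -/
def reduceMod (N : ℕ) {r : ℕ} (n : Fin r → ℤ) : Fin r → ZMod N :=
  fun i => n i

theorem boxCount_reduceMod_fiber {N r : ℕ} (w : Fin r → ZMod N) (B : ℕ) :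
    boxCount (reduceMod N ⁻¹' {w}) B = ∏ i, lineCount {x | (x : ZMod N) = w i} B := by
  rw [← boxCount_univ_pi]
  congr 1
  ext n
  simp only [Set.mem_preimage, Set.mem_singleton_iff, funext_iff, reduceMod, Set.mem_univ_pi,
    Set.mem_ofPred_eq]

theorem boxCount_reduceMod_preimage_le {N r : ℕ} [NeZero N] (W : Set (Fin r → ZMod N)) (B : ℕ) :
    boxCount (reduceMod N ⁻¹' W) B ≤ (B / N + 1) ^ r * W.ncard := by
  refine ncard_le_mul_ncard_of_mapsTo (Set.toFinite W) (fun n hn => hn.1) fun w _ => ?_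
  refine (Set.ncard_le_ncard (t := reduceMod N ⁻¹' {w} ∩ box r B) fun n hn =>
    ⟨hn.2, hn.1.2⟩).trans ((boxCount_reduceMod_fiber w B).trans_le ?_)
  calc ∏ i, lineCount {x | (x : ZMod N) = w i} B ≤ ∏ _i : Fin r, (B / N + 1) :=
        Finset.prod_le_prod' fun i _ => (lineCount_residue_mem_Icc (w i) B).2
    _ = (B / N + 1) ^ r := by simp

theorem le_boxCount_reduceMod_preimage {N r : ℕ} [NeZero N] (W : Set (Fin r → ZMod N)) (B : ℕ) :
    (B / N) ^ r * W.ncard ≤ boxCount (reduceMod N ⁻¹' W) B := by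
  refine mul_ncard_le_ncard_of_mapsTo (f := reduceMod N) (Set.toFinite _) (Set.toFinite W)
    (fun n hn => hn.1) fun w hw => ?_
  refine le_trans ?_ ((boxCount_reduceMod_fiber w B).ge.trans (Set.ncard_le_ncard ?_))
  · calc (B / N) ^ r = ∏ _i : Fin r, B / N := by simp
      _ ≤ ∏ i, lineCount {x | (x : ZMod N) = w i} B :=
        Finset.prod_le_prod' fun i _ => (lineCount_residue_mem_Icc (w i) B).1
  · rintro n ⟨rfl, hn⟩
    exact ⟨⟨hw, hn⟩, rfl⟩

theorem hasDensity_reduceMod_preimage {N r : ℕ} [NeZero N] (W : Set (Fin r → ZMod N)) :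
    HasDensity (reduceMod N ⁻¹' W) (W.ncard / (N : ℝ) ^ r) := by
  have hdiv : Tendsto (fun B : ℕ => ((B / N : ℕ) : ℝ) / B) atTop (𝓝 (N : ℝ)⁻¹) := by
    refine ((tendsto_nat_floor_mul_div_atTop (inv_nonneg.2 N.cast_nonneg)).comp
      tendsto_natCast_atTop_atTop).congr fun B => ?_
    rw [Function.comp_apply, inv_mul_eq_div, Nat.floor_div_eq_div]
  have hdiv' : Tendsto (fun B : ℕ => ((B / N + 1 : ℕ) : ℝ) / B) atTop (𝓝 (N : ℝ)⁻¹) := by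
    simpa [add_div] using hdiv.add tendsto_one_div_atTop_nhds_zero_nat
  rw [hasDensity_iff, div_eq_inv_mul, ← inv_pow]
  refine tendsto_of_tendsto_of_tendsto_of_le_of_le ((hdiv.pow r).mul_const _)
    ((hdiv'.pow r).mul_const _) (fun B => ?_) fun B => ?_
  · rw [div_pow, div_mul_eq_mul_div]
    gcongr
    exact_mod_cast le_boxCount_reduceMod_preimage W B
  · rw [div_pow, div_mul_eq_mul_div]
    gcongr
    rw [← Nat.cast_pow, ← Nat.cast_mul, Nat.cast_le]
    exact boxCount_reduceMod_preimage_le W B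

theorem hasDensity_iInter_reduceMod_preimage {ι : Type*} [Fintype ι] {r : ℕ} {m : ι → ℕ}
    [∀ i, NeZero (m i)] (hm : Pairwise (Function.onFun Nat.Coprime m))
    (W : ∀ i, Set (Fin r → ZMod (m i))) :
    HasDensity (⋂ i, reduceMod (m i) ⁻¹' W i) (∏ i, (W i).ncard / (m i : ℝ) ^ r) := by
  have : NeZero (∏ i, m i) := ⟨Finset.prod_ne_zero_iff.2 fun i _ => NeZero.ne (m i)⟩
  let e : (Fin r → ZMod (∏ i, m i)) ≃ ∀ i, Fin r → ZMod (m i) :=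
    (Equiv.piCongrRight fun _ => (ZMod.prodEquivPi m hm).toEquiv).trans (Equiv.piComm _)
  have he (n : Fin r → ℤ) (i : ι) : e (reduceMod (∏ i, m i) n) i = reduceMod (m i) n := by
    ext k
    change ZMod.prodEquivPi m hm (n k : ZMod (∏ i, m i)) i = n k
    rw [map_intCast, Pi.intCast_apply]
  have hpre : ⋂ i, reduceMod (m i) ⁻¹' W i = reduceMod (∏ i, m i) ⁻¹' (e ⁻¹' Set.univ.pi W) := by
    ext n
    simp only [Set.mem_iInter, Set.mem_preimage, Set.mem_univ_pi, he]
  have hcard : (e ⁻¹' Set.univ.pi W).ncard = ∏ i, (W i).ncard := by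
    rw [Set.ncard_preimage_of_injective_subset_range e.injective (by simp), ncard_univ_pi]
  have := hasDensity_reduceMod_preimage (e ⁻¹' Set.univ.pi W)
  rw [← hpre, hcard] at this
  simpa [Finset.prod_div_distrib, Finset.prod_pow] using this

/-! ### Common zeros modulo `p` -/

/-- The points at which the values of all members of `S` are divisible by `p`. -/
def commonZerosMod {r : ℕ} (S : Finset (MvPolynomial (Fin r) ℤ)) (p : ℕ) : Set (Fin r → ℤ) :=
  {n | ∀ f ∈ S, (p : ℤ) ∣ eval n f}

section CommonZeros

variable {r : ℕ} {S : Finset (MvPolynomial (Fin r) ℤ)} {p : ℕ}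

theorem intCast_dvd_eval_iff (n : Fin r → ℤ) (f : MvPolynomial (Fin r) ℤ) :
    (p : ℤ) ∣ eval n f ↔ eval (reduceMod p n) (map (Int.castRingHom (ZMod p)) f) = 0 := by
  rw [← ZMod.intCast_zmod_eq_zero_iff_dvd, eval_map, ← eq_intCast (Int.castRingHom (ZMod p)),
    ← eval₂_id, eval₂_comp_left]
  rfl

theorem commonZerosMod_eq_preimage (S : Finset (MvPolynomial (Fin r) ℤ)) (p : ℕ) :
    commonZerosMod S p = reduceMod p ⁻¹'
      {n | ∀ f ∈ S, eval n (map (Int.castRingHom (ZMod p)) f) = 0} := by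
  ext n
  simp only [commonZerosMod, Set.mem_ofPred_eq, Set.mem_preimage, intCast_dvd_eval_iff]

theorem mem_goodSet_iff {n : Fin r → ℤ} :
    n ∈ goodSet S ↔ ∀ p : ℕ, p.Prime → n ∉ commonZerosMod S p := by
  rw [goodSet, Set.mem_ofPred_eq, ← Finset.normalize_gcd, normalize_eq_one,
    Int.isUnit_iff_natAbs_eq, Nat.eq_one_iff_not_exists_prime_dvd]
  simp only [commonZerosMod, Set.mem_ofPred_eq, ← Int.natCast_dvd, Finset.dvd_gcd_iff]

theorem commonZerosMod_products {ℓ : ℕ} (F : Fin ℓ → Finset (MvPolynomial (Fin r) ℤ))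
    (hp : p.Prime) : commonZerosMod (products F) p = ⋃ j, commonZerosMod (F j) p := by
  ext n
  simp only [commonZerosMod, products, Finset.forall_mem_image, Fintype.mem_piFinset,
    Set.mem_ofPred_eq, Set.mem_iUnion, map_prod, (Nat.prime_iff_prime_int.1 hp).dvd_finsetProd_iff,
    Finset.mem_univ, true_and]
  constructor
  · intro h
    by_contra! hF
    choose A hA hpA using hF
    obtain ⟨j, hj⟩ := h hA
    exact hpA j hj
  · rintro ⟨j, hj⟩ A hA
    exact ⟨j, hj _ (hA j)⟩

theorem iInter_goodSet {ℓ : ℕ} (F : Fin ℓ → Finset (MvPolynomial (Fin r) ℤ)) :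
    ⋂ j, goodSet (F j) = goodSet (products F) := by
  ext n
  simp only [Set.mem_iInter, mem_goodSet_iff]
  rw [forall_comm]
  refine forall_congr' fun p => ?_
  rw [forall_comm]
  refine forall_congr' fun hp => ?_
  rw [commonZerosMod_products F hp, Set.mem_iUnion, not_exists]

theorem reduceMod_surjective (N r : ℕ) : Function.Surjective (reduceMod N : (Fin r → ℤ) → _) :=
  fun w => ⟨fun i => (w i).cast, funext fun i => ZMod.intCast_zmod_cast (w i)⟩

theorem zeroCount_le [NeZero p] : zeroCount S p ≤ p ^ r :=
  (Set.ncard_le_ncard (Set.subset_univ _)).trans_eq (by simp [Set.ncard_univ])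

theorem zeroCount_eq_pow_iff [NeZero p] :
    zeroCount S p = p ^ r ↔ commonZerosMod S p = Set.univ := by
  rw [commonZerosMod_eq_preimage, ← Set.preimage_univ (f := reduceMod p),
    (reduceMod_surjective p r).preimage_injective.eq_iff, Set.eq_univ_iff_ncard, Nat.card_fun]
  simp [zeroCount]

theorem hasDensity_sieve (S : Finset (MvPolynomial (Fin r) ℤ)) (P : Finset Nat.Primes) :
    HasDensity {n | ∀ p ∈ P, n ∉ commonZerosMod S p}
      (∏ p ∈ P, (1 - (zeroCount S p : ℝ) / (p : ℝ) ^ r)) := by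
  have (p : Nat.Primes) : NeZero (p : ℕ) := ⟨p.prop.ne_zero⟩
  have hcop : Pairwise (Function.onFun Nat.Coprime fun p : P => (p.1 : ℕ)) := fun p q hpq =>
    (Nat.coprime_primes p.1.2 q.1.2).2 fun h => hpq (Subtype.ext (Subtype.ext h))
  convert hasDensity_iInter_reduceMod_preimage hcop fun p : P =>
    {n | ∀ f ∈ S, eval n (map (Int.castRingHom (ZMod p.1)) f) = 0}ᶜ using 1
  · ext n
    simp [commonZerosMod_eq_preimage]
  · rw [← Finset.prod_coe_sort]
    refine Finset.prod_congr rfl fun p _ => ?_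
    have hp : ((p.1 : ℕ) : ℝ) ^ r ≠ 0 := pow_ne_zero _ (Nat.cast_ne_zero.2 (NeZero.ne _))
    rw [Set.ncard_compl, Nat.card_fun]
    rw [← zeroCount, Nat.cast_sub (by simpa using zeroCount_le)]
    simp [sub_div, hp]

end CommonZeros

/-! ### Values of one polynomial -/

section Values

variable {r : ℕ} {h : MvPolynomial (Fin r) ℤ}

theorem card_mul_card_zeros_le {R : Type*} [CommRing R] [IsDomain R] [DecidableEq R]
    {f : MvPolynomial (Fin r) R} (hf : f ≠ 0) (s : Finset R) :
    s.card * {x ∈ Fintype.piFinset fun _ : Fin r => s | eval x f = 0}.card ≤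
      f.totalDegree * s.card ^ r := by
  rcases s.eq_empty_or_nonempty with rfl | hs
  · simp
  have hs0 : (0 : ℚ≥0) < s.card := Nat.cast_pos.2 hs.card_pos
  have hSZ := schwartz_zippel_totalDegree hf s
  rw [div_le_div_iff₀ (pow_pos hs0 r) hs0, mul_comm] at hSZ
  exact_mod_cast hSZ

theorem mul_boxCount_zeros_le (h0 : h ≠ 0) (B : ℕ) :
    B * boxCount {n | eval n h = 0} B ≤ h.totalDegree * B ^ r := by
  have hcount : boxCount {n | eval n h = 0} B =
      {x ∈ Fintype.piFinset fun _ : Fin r => Finset.Ico (0 : ℤ) B | eval x h = 0}.card := by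
    rw [boxCount, box_eq_pi, ← Set.ncard_coe_finset, Finset.coe_filter]
    congr 1
    ext n
    simp [and_comm]
  simpa [hcount] using card_mul_card_zeros_le h0 (Finset.Ico (0 : ℤ) B)

theorem mul_div_add_one_le {p B : ℕ} (hpB : p ≤ B) : p * (B / p + 1) ≤ 2 * B := by
  have := Nat.mul_div_le B p
  lia

theorem mul_boxCount_dvd_eval_le {p B : ℕ} (hp : p.Prime)
    (h0 : map (Int.castRingHom (ZMod p)) h ≠ 0) (hpB : p ≤ B) :
    p * boxCount {n | (p : ℤ) ∣ eval n h} B ≤ h.totalDegree * (2 * B) ^ r := by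
  have := Fact.mk hp
  let W : Set (Fin r → ZMod p) := {w | eval w (map (Int.castRingHom (ZMod p)) h) = 0}
  have hpre : {n | (p : ℤ) ∣ eval n h} = reduceMod p ⁻¹' W := by
    ext n
    exact intCast_dvd_eval_iff n h
  have hW : p * W.ncard ≤ h.totalDegree * p ^ r := by
    have hSZ := card_mul_card_zeros_le h0 Finset.univ
    rw [Finset.card_univ, ZMod.card, Fintype.piFinset_univ, ← Set.ncard_coe_finset,
      Finset.coe_filter] at hSZ
    simp only [Finset.mem_univ, true_and] at hSZ
    refine hSZ.trans (Nat.mul_le_mul_right _ ?_)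
    exact Finset.sup_mono (support_map_subset _ _)
  calc p * boxCount {n | (p : ℤ) ∣ eval n h} B
      ≤ p * ((B / p + 1) ^ r * W.ncard) := by
        rw [hpre]
        exact Nat.mul_le_mul_left _ (boxCount_reduceMod_preimage_le W B)
    _ = (B / p + 1) ^ r * (p * W.ncard) := by ring
    _ ≤ (B / p + 1) ^ r * (h.totalDegree * p ^ r) := Nat.mul_le_mul_left _ hW
    _ = h.totalDegree * (p * (B / p + 1)) ^ r := by rw [mul_pow]; ring
    _ ≤ h.totalDegree * (2 * B) ^ r :=
        Nat.mul_le_mul_left _ (Nat.pow_le_pow_left (mul_div_add_one_le hpB) r)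

theorem eventually_map_castRingHom_zmod_ne_zero (h0 : h ≠ 0) :
    ∀ᶠ p : ℕ in atTop, map (Int.castRingHom (ZMod p)) h ≠ 0 := by
  obtain ⟨m, hm⟩ := ne_zero_iff.1 h0
  filter_upwards [eventually_gt_atTop (h.coeff m).natAbs] with p hp hp0
  have hdvd : (p : ℤ) ∣ h.coeff m := by
    rw [← ZMod.intCast_zmod_eq_zero_iff_dvd, ← eq_intCast (Int.castRingHom (ZMod p)), ← coeff_map,
      hp0, coeff_zero]
  exact hm (Int.eq_zero_of_dvd_of_natAbs_lt_natAbs hdvd (by simpa using hp))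

theorem natAbs_eval_le (h : MvPolynomial (Fin r) ℤ) {B : ℕ} (hB : 0 < B) {n : Fin r → ℤ}
    (hn : n ∈ box r B) :
    (eval n h).natAbs ≤ (∑ m ∈ h.support, (h.coeff m).natAbs) * B ^ h.totalDegree := by
  rw [eval_eq', Finset.sum_mul]
  refine (Int.natAbs_sum_le _ _).trans (Finset.sum_le_sum fun m hm => ?_)
  rw [Int.natAbs_mul]
  gcongr
  calc (∏ i, n i ^ m i).natAbs = ∏ i, (n i).natAbs ^ m i := by
        simp only [← Int.natAbsHom_apply, map_prod, map_pow]
    _ ≤ ∏ i, B ^ m i := by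
        gcongr with i
        have := hn i
        lia
    _ = B ^ ∑ i, m i := Finset.prod_pow_eq_pow_sum _ _ _
    _ ≤ B ^ h.totalDegree := by
        rw [← Finsupp.degree_eq_sum]
        exact Nat.pow_le_pow_right hB (le_totalDegree hm)

theorem card_primeFactors_gt_le {a B e : ℕ} (ha : a ≠ 0) (haB : a < B ^ (e + 1)) :
    {p ∈ a.primeFactors | B < p}.card ≤ e := by
  by_contra! he
  have hB : 0 < B := Nat.pos_of_ne_zero (by rintro rfl; simp at haB)
  refine haB.not_ge ?_
  calc B ^ (e + 1) ≤ B ^ {p ∈ a.primeFactors | B < p}.card := Nat.pow_le_pow_right hB he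
    _ ≤ ∏ p ∈ a.primeFactors with B < p, p :=
        Finset.pow_card_le_prod _ _ _ fun p hp => (Finset.mem_filter.1 hp).2.le
    _ ≤ ∏ p ∈ a.primeFactors, p :=
        Finset.prod_le_prod_of_subset_of_one_le' (Finset.filter_subset _ _) fun p hp _ =>
          (Nat.prime_of_mem_primeFactors hp).one_le
    _ ≤ a := Nat.le_of_dvd (Nat.pos_of_ne_zero ha) (Nat.prod_primeFactors_dvd a)

theorem eventually_card_primeFactors_eval_gt_le (h : MvPolynomial (Fin r) ℤ) :
    ∀ᶠ B : ℕ in atTop, ∀ n ∈ box r B, eval n h ≠ 0 →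
      {p ∈ (eval n h).natAbs.primeFactors | B < p}.card ≤ h.totalDegree := by
  filter_upwards [eventually_gt_atTop (∑ m ∈ h.support, (h.coeff m).natAbs)] with B hB n hn hn0
  have hB0 : 0 < B := hB.bot_lt
  refine card_primeFactors_gt_le (Int.natAbs_ne_zero.2 hn0) ((natAbs_eval_le h hB0 hn).trans_lt ?_)
  rw [pow_succ']
  gcongr

end Values

/-! ### Ekedahl's sieve -/

section Ekedahl

theorem lineCount_le (A : Set ℤ) (B : ℕ) : lineCount A B ≤ B :=
  (Set.ncard_le_ncard Set.inter_subset_right (Set.finite_Ico _ _)).trans_eq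
    (by simp [Set.ncard_eq_toFinset_card'])

theorem boxCount_tail_preimage_le {r : ℕ} (U : Set (Fin r → ℤ)) (B : ℕ) :
    boxCount (Fin.tail ⁻¹' U : Set (Fin (r + 1) → ℤ)) B ≤ B * boxCount U B :=
  boxCount_le_mul_boxCount_of_tail (fun _ hm _ => hm) fun _ _ _ => lineCount_le _ _

theorem dvd_eval_tail_of_rename_succ_mem_span {r p : ℕ}
    {S : Finset (MvPolynomial (Fin (r + 1)) ℤ)} {h : MvPolynomial (Fin r) ℤ}
    (hh : rename Fin.succ h ∈ Ideal.span (S : Set (MvPolynomial (Fin (r + 1)) ℤ)))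
    {m : Fin (r + 1) → ℤ} (hm : m ∈ commonZerosMod S p) : (p : ℤ) ∣ eval (Fin.tail m) h := by
  have hle : Ideal.span (S : Set (MvPolynomial (Fin (r + 1)) ℤ)) ≤
      (Ideal.span {(p : ℤ)}).comap (eval m) :=
    Ideal.span_le.2 fun f hf => Ideal.mem_span_singleton.2 (hm f hf)
  have := Ideal.mem_span_singleton.1 (hle hh)
  rwa [eval_rename] at this

/-- The points of `commonZerosMod S p` over which the fiber in the direction of the variable of
index `0` consists of roots of a nonzero polynomial modulo `p`. -/
def transverseZeros {r : ℕ} (S : Finset (MvPolynomial (Fin (r + 1)) ℤ)) (p : ℕ) :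
    Set (Fin (r + 1) → ℤ) :=
  {m ∈ commonZerosMod S p | Fin.tail m ∉ commonZerosMod (coeffFamily S) p}

/-- The points at which a prime greater than `M` divides the values of all members of `S`. -/
def largePrimeSet {r : ℕ} (S : Finset (MvPolynomial (Fin r) ℤ)) (M : ℕ) : Set (Fin r → ℤ) :=
  {n | ∃ p : ℕ, p.Prime ∧ M < p ∧ n ∈ commonZerosMod S p}

variable {r : ℕ} {S : Finset (MvPolynomial (Fin (r + 1)) ℤ)} {d p : ℕ}
  {h : MvPolynomial (Fin r) ℤ}

theorem lineCount_transverseZeros_le (hd : ∀ f ∈ S, degreeOf 0 f ≤ d) (hp : p.Prime)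
    (n : Fin r → ℤ) (B : ℕ) :
    lineCount {x | (Fin.cons x n : Fin (r + 1) → ℤ) ∈ transverseZeros S p} B ≤
      d * (B / p + 1) := by
  have := Fact.mk hp
  by_cases hn : n ∈ commonZerosMod (coeffFamily S) p
  · simp [lineCount, transverseZeros, hn]
  obtain ⟨f, hf, i, hi⟩ : ∃ f ∈ S, ∃ i, ¬ (p : ℤ) ∣ eval n ((finSuccEquiv ℤ r f).coeff i) := by
    simp only [commonZerosMod, Set.mem_ofPred_eq, not_forall] at hn
    obtain ⟨g, hg, hgp⟩ := hn
    obtain ⟨f, hf, hgf⟩ := mem_coeffFamily.1 hg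
    obtain ⟨i, -, rfl⟩ := Polynomial.mem_coeffs_iff.1 hgf
    exact ⟨f, hf, i, hgp⟩
  let G : Polynomial (ZMod p) :=
    ((finSuccEquiv ℤ r f).map (eval n)).map (Int.castRingHom (ZMod p))
  have hG : G ≠ 0 := fun hG => hi <| by
    have := congrArg (Polynomial.coeff · i) hG
    simpa only [G, Polynomial.coeff_map, Polynomial.coeff_zero, eq_intCast,
      ZMod.intCast_zmod_eq_zero_iff_dvd] using this
  have hroot (x : ℤ) (hx : (Fin.cons x n : Fin (r + 1) → ℤ) ∈ transverseZeros S p) :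
      (x : ZMod p) ∈ G.roots.toFinset := by
    have := hx.1 f hf
    rwa [Multiset.mem_toFinset, Polynomial.mem_roots hG, Polynomial.IsRoot.def,
      Polynomial.eval_intCast_map, ← eval_eq_eval_mv_eval', eq_intCast,
      ZMod.intCast_zmod_eq_zero_iff_dvd]
  have hcard : G.roots.toFinset.card ≤ d :=
    calc G.roots.toFinset.card ≤ G.natDegree :=
          (Multiset.toFinset_card_le _).trans (Polynomial.card_roots' G)
      _ ≤ (finSuccEquiv ℤ r f).natDegree :=
          Polynomial.natDegree_map_le.trans Polynomial.natDegree_map_le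
      _ ≤ d := (natDegree_finSuccEquiv f).trans_le (hd f hf)
  calc lineCount {x | (Fin.cons x n : Fin (r + 1) → ℤ) ∈ transverseZeros S p} B
      ≤ lineCount {x | (x : ZMod p) ∈ (G.roots.toFinset : Set (ZMod p))} B :=
        Set.ncard_le_ncard (Set.inter_subset_inter_left _ hroot)
          ((Set.finite_Ico _ _).inter_of_right _)
    _ ≤ (B / p + 1) * G.roots.toFinset.card :=
        (lineCount_cast_mem_le _ B).trans_eq (by rw [Set.ncard_coe_finset])
    _ ≤ d * (B / p + 1) := by rw [mul_comm]; gcongr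

theorem sq_mul_boxCount_transverseZeros_le (hd : ∀ f ∈ S, degreeOf 0 f ≤ d)
    (hh : rename Fin.succ h ∈ Ideal.span (S : Set (MvPolynomial (Fin (r + 1)) ℤ)))
    (hp : p.Prime) (h0 : map (Int.castRingHom (ZMod p)) h ≠ 0) {B : ℕ} (hpB : p ≤ B) :
    p ^ 2 * boxCount (transverseZeros S p) B ≤ d * h.totalDegree * (2 * B) ^ (r + 1) := by
  have hfiber : boxCount (transverseZeros S p) B ≤
      d * (B / p + 1) * boxCount {n | (p : ℤ) ∣ eval n h} B :=
    boxCount_le_mul_boxCount_of_tail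
      (fun m hm _ => dvd_eval_tail_of_rename_succ_mem_span hh hm.1)
      fun n _ _ => lineCount_transverseZeros_le hd hp n B
  calc p ^ 2 * boxCount (transverseZeros S p) B
      ≤ p ^ 2 * (d * (B / p + 1) * boxCount {n | (p : ℤ) ∣ eval n h} B) :=
        Nat.mul_le_mul_left _ hfiber
    _ = d * (p * (B / p + 1)) * (p * boxCount {n | (p : ℤ) ∣ eval n h} B) := by ring
    _ ≤ d * (2 * B) * (h.totalDegree * (2 * B) ^ r) :=
        Nat.mul_le_mul (Nat.mul_le_mul_left d (mul_div_add_one_le hpB))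
          (mul_boxCount_dvd_eval_le hp h0 hpB)
    _ = d * h.totalDegree * (2 * B) ^ (r + 1) := by ring

theorem exists_degreeOf_le (S : Finset (MvPolynomial (Fin (r + 1)) ℤ)) :
    ∃ d, ∀ f ∈ S, degreeOf 0 f ≤ d :=
  ⟨S.sup (degreeOf 0), fun _ => Finset.le_sup⟩

theorem CoprimeUpToConst.exists_boxCount_mediumPrimes_le (hS : CoprimeUpToConst S) :
    ∃ K : ℝ, ∀ᶠ M : ℕ in atTop, ∀ B : ℕ,
      (boxCount (⋃ p ∈ {p ∈ Finset.Ioo M (B + 1) | p.Prime}, transverseZeros S p) B : ℝ) ≤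
        K / (M + 1) * (B : ℝ) ^ (r + 1) := by
  obtain ⟨h, h0, hh⟩ := hS.exists_rename_succ_mem_span
  obtain ⟨d, hd⟩ := exists_degreeOf_le S
  refine ⟨d * h.totalDegree * 2 ^ (r + 1) * 2, ?_⟩
  filter_upwards [eventually_forall_ge_atTop.2 (eventually_map_castRingHom_zmod_ne_zero h0)]
    with M hM B
  let K₀ : ℝ := d * h.totalDegree * (2 * B) ^ (r + 1)
  calc (boxCount (⋃ p ∈ {p ∈ Finset.Ioo M (B + 1) | p.Prime}, transverseZeros S p) B : ℝ)
      ≤ ∑ p ∈ Finset.Ioo M (B + 1) with p.Prime, (boxCount (transverseZeros S p) B : ℝ) := by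
        exact_mod_cast boxCount_biUnion_le _ _ B
    _ ≤ ∑ p ∈ Finset.Ioo M (B + 1) with p.Prime, K₀ * ((p : ℝ) ^ 2)⁻¹ := by
        refine Finset.sum_le_sum fun p hp => ?_
        obtain ⟨hpI, hp⟩ := Finset.mem_filter.1 hp
        obtain ⟨hMp, hpB⟩ := Finset.mem_Ioo.1 hpI
        rw [← div_eq_mul_inv, le_div_iff₀' (pow_pos (Nat.cast_pos.2 hp.pos) 2)]
        simp only [K₀]
        exact_mod_cast sq_mul_boxCount_transverseZeros_le hd hh hp (hM p hMp.le)
          (Nat.lt_succ_iff.1 hpB)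
    _ ≤ ∑ p ∈ Finset.Ioo M (B + 1), K₀ * ((p : ℝ) ^ 2)⁻¹ :=
        Finset.sum_le_sum_of_subset_of_nonneg (Finset.filter_subset _ _) fun _ _ _ => by
          simp only [K₀]
          positivity
    _ ≤ K₀ * (2 / (M + 1)) := by
        rw [← Finset.mul_sum]
        simp only [K₀]
        gcongr
        exact sum_Ioo_inv_sq_le M (B + 1)
    _ = d * h.totalDegree * 2 ^ (r + 1) * 2 / (M + 1) * (B : ℝ) ^ (r + 1) := by
        simp only [K₀, mul_pow]
        ring

theorem lineCount_hugePrimes_le (hd : ∀ f ∈ S, degreeOf 0 f ≤ d)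
    (hh : rename Fin.succ h ∈ Ideal.span (S : Set (MvPolynomial (Fin (r + 1)) ℤ)))
    {n : Fin r → ℤ} (hn : eval n h ≠ 0) (B : ℕ) :
    lineCount {x | ∃ p : ℕ, p.Prime ∧ B < p ∧
        (Fin.cons x n : Fin (r + 1) → ℤ) ∈ transverseZeros S p} B ≤
      {p ∈ (eval n h).natAbs.primeFactors | B < p}.card * d := by
  set s := {p ∈ (eval n h).natAbs.primeFactors | B < p}
  let A (p : ℕ) : Set ℤ := {x | (Fin.cons x n : Fin (r + 1) → ℤ) ∈ transverseZeros S p}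
  calc lineCount {x | ∃ p : ℕ, p.Prime ∧ B < p ∧ x ∈ A p} B
      ≤ (⋃ p ∈ s, A p ∩ Set.Ico 0 (B : ℤ)).ncard := by
        refine Set.ncard_le_ncard ?_ ((Set.finite_Ico 0 (B : ℤ)).subset
          (Set.iUnion₂_subset fun _ _ => Set.inter_subset_right))
        rintro x ⟨⟨p, hp, hBp, hx⟩, hxB⟩
        have hpn : (p : ℤ) ∣ eval n h := by
          simpa only [Fin.tail_cons] using dvd_eval_tail_of_rename_succ_mem_span hh hx.1
        have hps : p ∈ s := Finset.mem_filter.2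
          ⟨Nat.mem_primeFactors.2 ⟨hp, Int.natCast_dvd.1 hpn, Int.natAbs_ne_zero.2 hn⟩, hBp⟩
        exact Set.mem_biUnion (x := p) hps ⟨hx, hxB⟩
    _ ≤ ∑ p ∈ s, lineCount (A p) B := Finset.set_ncard_biUnion_le s _
    _ ≤ s.card * d := by
        rw [← smul_eq_mul]
        refine Finset.sum_le_card_nsmul _ _ _ fun p hp => ?_
        obtain ⟨hp, hBp⟩ := Finset.mem_filter.1 hp
        have := lineCount_transverseZeros_le hd (Nat.prime_of_mem_primeFactors hp) n B
        rwa [Nat.div_eq_of_lt hBp, zero_add, mul_one] at this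

theorem CoprimeUpToConst.exists_boxCount_hugePrimes_le (hS : CoprimeUpToConst S) :
    ∃ K : ℕ, ∀ᶠ B : ℕ in atTop,
      boxCount {m | ∃ p : ℕ, p.Prime ∧ B < p ∧ m ∈ transverseZeros S p} B ≤ K * B ^ r := by
  obtain ⟨h, h0, hh⟩ := hS.exists_rename_succ_mem_span
  obtain ⟨d, hd⟩ := exists_degreeOf_le S
  refine ⟨h.totalDegree + h.totalDegree * d, ?_⟩
  filter_upwards [eventually_card_primeFactors_eval_gt_le h] with B hB
  set H := {m | ∃ p : ℕ, p.Prime ∧ B < p ∧ m ∈ transverseZeros S p}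
  set Z : Set (Fin r → ℤ) := {n | eval n h = 0}
  have hgeneric : boxCount (H \ Fin.tail ⁻¹' Z) B ≤
      h.totalDegree * d * boxCount (Set.univ : Set (Fin r → ℤ)) B := by
    refine boxCount_le_mul_boxCount_of_tail (fun _ _ _ => trivial) fun n _ hnB => ?_
    by_cases hn : eval n h = 0
    · simp [lineCount, Z, hn]
    refine le_trans ?_ ((lineCount_hugePrimes_le hd hh hn B).trans
      (Nat.mul_le_mul_right d (hB n hnB hn)))
    exact Set.ncard_le_ncard (Set.inter_subset_inter_left _ fun x hx => hx.1)
      ((Set.finite_Ico _ _).inter_of_right _)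
  calc boxCount H B ≤ boxCount (Fin.tail ⁻¹' Z ∪ H \ Fin.tail ⁻¹' Z) B :=
        boxCount_mono fun m hm => by rw [Set.union_sdiff_self]; exact Or.inr hm.1
    _ ≤ B * boxCount Z B + h.totalDegree * d * boxCount (Set.univ : Set (Fin r → ℤ)) B :=
        (boxCount_union_le _ _ B).trans (add_le_add (boxCount_tail_preimage_le Z B) hgeneric)
    _ ≤ h.totalDegree * B ^ r + h.totalDegree * d * B ^ r := by
        rw [boxCount_univ]
        exact Nat.add_le_add_right (mul_boxCount_zeros_le h0 B) _
    _ = (h.totalDegree + h.totalDegree * d) * B ^ r := by ring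

theorem largePrimeSet_subset (S : Finset (MvPolynomial (Fin (r + 1)) ℤ)) (M B : ℕ) :
    largePrimeSet S M ⊆ Fin.tail ⁻¹' largePrimeSet (coeffFamily S) M ∪
      ((⋃ p ∈ {p ∈ Finset.Ioo M (B + 1) | p.Prime}, transverseZeros S p) ∪
        {m | ∃ p : ℕ, p.Prime ∧ B < p ∧ m ∈ transverseZeros S p}) := by
  rintro m ⟨p, hp, hMp, hm⟩
  by_cases hcoeff : Fin.tail m ∈ commonZerosMod (coeffFamily S) p
  · exact Or.inl ⟨p, hp, hMp, hcoeff⟩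
  rcases le_or_gt p B with hpB | hBp
  · refine Or.inr (Or.inl (Set.mem_biUnion (x := p) ?_ ⟨hm, hcoeff⟩))
    exact Finset.mem_filter.2 ⟨Finset.mem_Ioo.2 ⟨hMp, Nat.lt_succ_iff.2 hpB⟩, hp⟩
  · exact Or.inr (Or.inr ⟨p, hp, hBp, hm, hcoeff⟩)

theorem CoprimeUpToConst.eventually_largePrimeSet_eq_empty
    {S : Finset (MvPolynomial (Fin 0) ℤ)} (hS : CoprimeUpToConst S) :
    ∀ᶠ M : ℕ in atTop, largePrimeSet S M = ∅ := by
  obtain ⟨f, hf, hf0⟩ : ∃ f ∈ S, f ≠ 0 := by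
    by_contra! hall
    obtain ⟨c, hc, hc0⟩ := hS 0 fun P hP => by rw [hall P hP]
    exact hc (C_eq_zero.1 hc0.symm)
  obtain ⟨c, rfl⟩ := C_surjective (Fin 0) f
  filter_upwards [eventually_ge_atTop c.natAbs] with M hM
  refine Set.eq_empty_of_forall_notMem fun n ⟨p, _, hMp, hn⟩ => hf0 ?_
  have hpc : (p : ℤ) ∣ c := by simpa using hn _ hf
  rw [Int.eq_zero_of_dvd_of_natAbs_lt_natAbs hpc (by simpa using hM.trans_lt hMp), C_0]

theorem CoprimeUpToConst.eventually_boxCount_largePrimeSet_le {r : ℕ}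
    {S : Finset (MvPolynomial (Fin r) ℤ)} (hS : CoprimeUpToConst S) {η : ℝ} (hη : 0 < η) :
    ∀ᶠ M : ℕ in atTop, ∀ᶠ B : ℕ in atTop,
      (boxCount (largePrimeSet S M) B : ℝ) ≤ η * (B : ℝ) ^ r := by
  induction r generalizing η with
  | zero =>
    filter_upwards [hS.eventually_largePrimeSet_eq_empty] with M hM
    exact Eventually.of_forall fun B => by simpa [hM, boxCount] using hη.le
  | succ r ih =>
    obtain ⟨K, hmedium⟩ := hS.exists_boxCount_mediumPrimes_le
    obtain ⟨L, hhuge⟩ := hS.exists_boxCount_hugePrimes_le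
    have hK : ∀ᶠ M : ℕ in atTop, K / (M + 1) ≤ η / 3 := by
      have := (tendsto_const_div_atTop_nhds_zero_nat K).comp (tendsto_add_atTop_nat 1)
      exact_mod_cast this.eventually_le_const (show 0 < η / 3 by positivity)
    have hL : ∀ᶠ B : ℕ in atTop, (L : ℝ) ≤ η / 3 * B :=
      (tendsto_natCast_atTop_atTop.const_mul_atTop (by positivity)).eventually_ge_atTop _
    filter_upwards [ih hS.coeffFamily (η := η / 3) (by positivity), hmedium, hK]
      with M hcoeff hM hMK
    filter_upwards [hcoeff, hhuge, hL] with B hcoeff hhuge hBL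
    calc (boxCount (largePrimeSet S M) B : ℝ)
        ≤ B * boxCount (largePrimeSet (PolyFamilies.coeffFamily S) M) B +
          (boxCount (⋃ p ∈ {p ∈ Finset.Ioo M (B + 1) | p.Prime}, transverseZeros S p) B +
            boxCount {m | ∃ p : ℕ, p.Prime ∧ B < p ∧ m ∈ transverseZeros S p} B) := by
          exact_mod_cast (boxCount_mono (Set.inter_subset_left.trans
            (largePrimeSet_subset S M B))).trans ((boxCount_union_le _ _ B).trans
            (add_le_add (boxCount_tail_preimage_le _ B) (boxCount_union_le _ _ B)))
      _ ≤ B * (η / 3 * (B : ℝ) ^ r) +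
          (η / 3 * (B : ℝ) ^ (r + 1) + η / 3 * B * (B : ℝ) ^ r) := by
          gcongr
          · exact (hM B).trans (by gcongr)
          · exact (show _ ≤ (L : ℝ) * (B : ℝ) ^ r by exact_mod_cast hhuge).trans (by gcongr)
      _ = η * (B : ℝ) ^ (r + 1) := by ring

end Ekedahl

/-! ### Density of the good set -/

section Density

theorem hasDensity_of_tendsto {r : ℕ} {T : Set (Fin r → ℤ)} {U : ℕ → Set (Fin r → ℤ)} {a : ℕ → ℝ}
    {δ : ℝ} (hU : ∀ M, HasDensity (U M) (a M)) (hTU : ∀ M, T ⊆ U M) (ha : Tendsto a atTop (𝓝 δ))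
    (hdiff : ∀ η > 0, ∀ᶠ M : ℕ in atTop, ∀ᶠ B : ℕ in atTop,
      (boxCount (U M \ T) B : ℝ) ≤ η * (B : ℝ) ^ r) :
    HasDensity T δ := by
  rw [hasDensity_iff, Metric.tendsto_nhds]
  intro ε hε
  obtain ⟨M, haM, hdiffM⟩ := ((Metric.tendsto_nhds.1 ha (ε / 3) (by positivity)).and
    (hdiff (ε / 3) (by positivity))).exists
  filter_upwards [Metric.tendsto_nhds.1 (hasDensity_iff.1 (hU M)) (ε / 3) (by positivity), hdiffM,
    eventually_gt_atTop 0] with B hUB hdiffB hB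
  have hBr : (0 : ℝ) < (B : ℝ) ^ r := by positivity
  have hlower : (boxCount T B : ℝ) / (B : ℝ) ^ r ≤ boxCount (U M) B / (B : ℝ) ^ r := by
    gcongr
    exact boxCount_mono (Set.inter_subset_left.trans (hTU M))
  have hupper : (boxCount (U M) B : ℝ) / (B : ℝ) ^ r ≤ boxCount T B / (B : ℝ) ^ r + ε / 3 := by
    have hcover : boxCount (U M) B ≤ boxCount T B + boxCount (U M \ T) B :=
      (boxCount_mono (Set.inter_subset_left.trans
        (Set.union_sdiff_cancel (hTU M)).superset)).trans (boxCount_union_le _ _ B)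
    rw [div_add' _ _ _ hBr.ne']
    gcongr
    exact (Nat.cast_le.2 hcover).trans (by push_cast; gcongr)
  rw [Real.dist_eq, abs_lt] at haM hUB ⊢
  constructor <;> linarith

theorem multipliable_of_mem_Icc {ι : Type*} {f : ι → ℝ} (hf : ∀ i, f i ∈ Set.Icc 0 1) :
    Multipliable f := by
  refine ⟨⨅ s : Finset ι, ∏ i ∈ s, f i, ?_⟩
  rw [HasProd, SummationFilter.unconditional_filter]
  refine tendsto_atTop_ciInf
    (Finset.prod_anti_set_of_le_one (fun i => (hf i).1) fun i => (hf i).2) ⟨0, ?_⟩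
  rintro _ ⟨s, rfl⟩
  exact Finset.prod_nonneg fun i _ => (hf i).1

variable {r : ℕ}

theorem multipliable_one_sub_zeroCount_div (S : Finset (MvPolynomial (Fin r) ℤ)) :
    Multipliable fun p : Nat.Primes => 1 - (zeroCount S p : ℝ) / ((p : ℕ) : ℝ) ^ r := by
  refine multipliable_of_mem_Icc fun p => ⟨?_, sub_le_self _ (by positivity)⟩
  have : NeZero (p : ℕ) := ⟨p.prop.ne_zero⟩
  exact sub_nonneg.2 (div_le_one_of_le₀ (by exact_mod_cast zeroCount_le) (by positivity))

theorem CoprimeUpToConst.hasDensity_goodSet {S : Finset (MvPolynomial (Fin r) ℤ)}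
    (hS : CoprimeUpToConst S) :
    HasDensity (goodSet S)
      (∏' p : Nat.Primes, (1 - (zeroCount S p : ℝ) / ((p : ℕ) : ℝ) ^ r)) := by
  let primesUpTo : ℕ → Finset Nat.Primes := fun M => (Finset.range (M + 1)).subtype Nat.Prime
  have mem_primesUpTo {M : ℕ} {p : Nat.Primes} : p ∈ primesUpTo M ↔ (p : ℕ) ≤ M :=
    Finset.mem_subtype.trans (Finset.mem_range.trans Nat.lt_succ_iff)
  have hprimes : Tendsto primesUpTo atTop atTop := tendsto_atTop_finset_of_monotone
    (fun M N hMN p hp => mem_primesUpTo.2 ((mem_primesUpTo.1 hp).trans hMN))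
    fun p => ⟨p, mem_primesUpTo.2 le_rfl⟩
  refine hasDensity_of_tendsto (fun M => hasDensity_sieve S (primesUpTo M))
    (fun M n hn p _ => mem_goodSet_iff.1 hn p p.prop)
    ((multipliable_one_sub_zeroCount_div S).hasProd.comp hprimes) fun η hη => ?_
  filter_upwards [hS.eventually_boxCount_largePrimeSet_le hη] with M hM
  filter_upwards [hM] with B hB
  refine (Nat.cast_le.2 (boxCount_mono (Set.inter_subset_left.trans ?_))).trans hB
  rintro n ⟨hsieve, hbad⟩
  rw [mem_goodSet_iff] at hbad
  push Not at hbad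
  obtain ⟨p, hp, hnp⟩ := hbad
  exact ⟨p, hp, lt_of_not_ge fun hpM => hsieve ⟨p, hp⟩ (mem_primesUpTo.2 hpM) hnp, hnp⟩

end Density

/-! ### Families of products -/

theorem coprimePolys_products {r ℓ : ℕ} {F : Fin ℓ → Finset (MvPolynomial (Fin r) ℤ)}
    (hF : ∀ j, CoprimePolys (F j)) : CoprimePolys (products F) := by
  rintro ⟨D, hD, hdvd⟩
  have hD0 : D ≠ 0 := by
    rintro rfl
    simp at hD
  obtain ⟨E, hE, hED⟩ := WfDvdMonoid.exists_irreducible_factor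
    (fun hunit => hD.ne' (isUnit_iff_totalDegree_of_isReduced.1 hunit).2) hD0
  have hE_deg : 0 < E.totalDegree := by
    refine Nat.pos_of_ne_zero fun hdeg => hE.not_isUnit ?_
    obtain ⟨c, rfl⟩ : ∃ c, E = C c := ⟨_, totalDegree_eq_zero_iff_eq_C.1 hdeg⟩
    exact (IsUnit.mk0 c fun hc => hE.ne_zero (by rw [hc, C_0])).map C
  have hndvd : ∀ j, ∃ P ∈ F j, ¬ E ∣ map (Int.castRingHom ℚ) P := by
    intro j
    by_contra! hall
    exact hF j ⟨E, hE_deg, hall⟩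
  choose A hA hEA using hndvd
  have hE_prod := hED.trans
    (hdvd (∏ j, A j) (Finset.mem_image_of_mem _ (Fintype.mem_piFinset.2 hA)))
  rw [map_prod, hE.prime.dvd_finsetProd_iff] at hE_prod
  obtain ⟨j, -, hj⟩ := hE_prod
  exact hEA j hj

theorem ne_zero_of_mem_products {r ℓ : ℕ} {F : Fin ℓ → Finset (MvPolynomial (Fin r) ℤ)}
    (hF : ∀ j, ∀ P ∈ F j, P ≠ 0) {Q : MvPolynomial (Fin r) ℤ} (hQ : Q ∈ products F) : Q ≠ 0 := by
  obtain ⟨A, hA, rfl⟩ := Finset.mem_image.1 hQ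
  exact Finset.prod_ne_zero_iff.2 fun j _ => hF j _ (Fintype.mem_piFinset.1 hA j)

end PolyFamilies

theorem proposition6p3 (r ℓ : ℕ) (hr : 1 ≤ r) (hℓ : 1 ≤ ℓ)
    (F : Fin ℓ → Finset (MvPolynomial (Fin r) ℤ))
    (hne : ∀ j, ∀ P ∈ F j, P ≠ 0)
    (hcop : ∀ j, PolyFamilies.CoprimePolys (F j)) :
    -- (a)
    ((∀ Q ∈ PolyFamilies.products F, Q ≠ 0) ∧
      PolyFamilies.CoprimePolys (PolyFamilies.products F)) ∧
    -- (b)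
    (⋂ j, PolyFamilies.goodSet (F j)) = PolyFamilies.goodSet (PolyFamilies.products F) ∧
    -- (c)
    (∃ δ : ℝ,
      HasProd (fun p : Nat.Primes =>
        1 - (PolyFamilies.zeroCount (PolyFamilies.products F) (p : ℕ) : ℝ) / ((p : ℕ) : ℝ) ^ r) δ ∧
      PolyFamilies.HasDensity (⋂ j, PolyFamilies.goodSet (F j)) δ) ∧
    -- (d)
    (∀ p : ℕ, p.Prime →
      (PolyFamilies.zeroCount (PolyFamilies.products F) p = p ^ r ↔
        ∀ n : Fin r → ℤ, ∃ j, ∀ P ∈ F j, (p : ℤ) ∣ MvPolynomial.eval n P)) := by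
  have hprod := PolyFamilies.coprimePolys_products hcop
  have hgood := PolyFamilies.iInter_goodSet F
  refine ⟨⟨fun Q => PolyFamilies.ne_zero_of_mem_products hne, hprod⟩, hgood,
    ⟨_, (PolyFamilies.multipliable_one_sub_zeroCount_div _).hasProd, ?_⟩, fun p hp => ?_⟩
  · rw [hgood]
    exact (hprod.coprimeUpToConst hr).hasDensity_goodSet
  · have : NeZero p := ⟨hp.ne_zero⟩
    rw [PolyFamilies.zeroCount_eq_pow_iff, PolyFamilies.commonZerosMod_products F hp,
      Set.eq_univ_iff_forall]
    exact forall_congr' fun n => Set.mem_iUnion
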